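/- Let $r\ge 1$ be an integer (the order). For an integer $n\ge 1$ let $t_{1-r}<t_{2-r}<\dots<t_{n+r-1}$ be real knots and put $[a,b]=[t_0,t_n]$. Let $b^{[1]}_i=\mathbf 1_{[t_i,t_{i+1})}$ and, for $s\ge 2$, $$b^{[s]}_i(x)=\frac{x-t_i}{t_{i+s-1}-t_i}\,b^{[s-1]}_i(x)+\frac{t_{i+s}-x}{t_{i+s}-t_{i+1}}\,b^{[s-1]}_{i+1}(x).$$ Consider on $[a,b]$ the two families of $n+r-1$ functions $\Phi_S=(b^{[r]}_i)_{i=1-r}^{n-1}$ (B-splines of order $r$) and $\Phi_R=(\mathrm{ReLU}(\cdot-t_i)^{r-1})_{i=1-r}^{n-1}$, where $\mathrm{ReLU}(y)=\max(y,0)$ and, for $r=1$, $\mathrm{ReLU}(x-t_i)^{0}$ means $\mathbf 1_{x\ge t_i}$. Let $\mu$ be the uniform probability measure on $[a,b]$, let $G_*=\int_{[a,b]}\Phi_*(x)\Phi_*(x)^T\,d\mu(x)$ for $*\in\{S,R\}$ be the Gram matrices, and let $\kappa(G)=\|G\|_2\|G^{-1}\|_2$ be the spectral condition number. Fix $r$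 and a constant $M$, and consider only knot sequences with $\max_i(t_{i+1}-t_i)\le M\,\min_i(t_{i+1}-t_i)$, the maximum and minimum being over $1-r\le i\le n+r-2$. Then $G_S$ and $G_R$ are always positive definite, and: 1. there is a constant $C=C(r,M)$ such that $\kappa(G_S)\le C$ for every $n\ge1$ and every such knot sequence; 2. $\kappa(G_R)$ is unbounded as the number of basis functions grows: for every $B$ there is $N=N(B,r,M)$ such that $\kappa(G_R)>B$ for every $n\ge N$ and every such knot sequence. -/

import Mathlib

open MeasureTheory ProbabilityTheory

noncomputable section

/-- The points `t_{1-r}, …, t_{n+r-1}` (that is, `n + 2r - 1` of them) are strictly increasing.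
The knots are indexed by integers; values of `t` at other indices are irrelevant. -/
def IsKnotSequence (r n : ℕ) (t : ℤ → ℝ) : Prop :=
  StrictMonoOn t (Set.Icc (1 - (r : ℤ)) ((n : ℤ) + r - 1))

/-- The largest distance between consecutive knots among `t_{1-r}, …, t_{n+r-1}` is at most `M`
times the smallest one. -/
def SpacingRatioLE (r n : ℕ) (t : ℤ → ℝ) (M : ℝ) : Prop :=
  ∀ i ∈ Set.Ico (1 - (r : ℤ)) ((n : ℤ) + r - 1), ∀ j ∈ Set.Ico (1 - (r : ℤ)) ((n : ℤ) + r - 1),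
    t (i + 1) - t i ≤ M * (t (j + 1) - t j)

/-- The B-spline `b_i^{[r]}` of order `r` (degree `r - 1`) with knots `t_i, …, t_{i+r}`, by the
Cox-de Boor recursion; `b_i^{[1]}` is the indicator of `[t_i, t_{i+1})`. Order `0` is a dummy. -/
def bspline (t : ℤ → ℝ) : ℕ → ℤ → ℝ → ℝ
  | 0, _, _ => 0
  | 1, i, x => if t i ≤ x ∧ x < t (i + 1) then 1 else 0
  | r + 2, i, x =>
      (x - t i) / (t (i + (r + 1)) - t i) * bspline t (r + 1) i x
        + (t (i + (r + 2)) - x) / (t (i + (r + 2)) - t (i + 1)) * bspline t (r + 1) (i + 1) x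

/-- The function `ReLU(x - t_i)^(r-1)`; for `r = 1` it is the unit step `1_{x ≥ t_i}`. -/
def reluPow (t : ℤ → ℝ) (r : ℕ) (i : ℤ) (x : ℝ) : ℝ :=
  if r = 1 then (if t i ≤ x then 1 else 0) else (max (x - t i) 0) ^ (r - 1)

/-- The index set `{1 - r, …, n - 1}` of both bases; it has `n + r - 1` elements. -/
abbrev BasisIndex (r n : ℕ) : Type := ↥(Finset.Icc (1 - (r : ℤ)) ((n : ℤ) - 1))

/-- The matrix `∫ Φ(x) Φ(x)ᵀ dμ(x)`, where `μ` is the uniform probability measure on `[a, b]`. -/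
def gramMatrix {ι : Type*} (a b : ℝ) (φ : ι → ℝ → ℝ) : Matrix ι ι ℝ :=
  Matrix.of fun i j => ∫ x, φ i x * φ j x ∂(cond volume (Set.Icc a b))

/-- The Gram matrix `G_S` of the B-spline basis of order `r` on `[t_0, t_n]`. -/
def gramSpline (r n : ℕ) (t : ℤ → ℝ) : Matrix (BasisIndex r n) (BasisIndex r n) ℝ :=
  gramMatrix (t 0) (t n) fun i => bspline t r (i : ℤ)

/-- The Gram matrix `G_R` of the `ReLU^(r-1)` basis on `[t_0, t_n]`. -/
def gramReLU (r n : ℕ) (t : ℤ → ℝ) : Matrix (BasisIndex r n) (BasisIndex r n) ℝ :=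
  gramMatrix (t 0) (t n) fun i => reluPow t r (i : ℤ)

/-- The spectral condition number `‖A‖₂ ‖A⁻¹‖₂` (meaningful for invertible `A`). -/
def condNumber {ι : Type*} [Fintype ι] [DecidableEq ι] (A : Matrix ι ι ℝ) : ℝ :=
  ‖Matrix.toEuclideanCLM (𝕜 := ℝ) A‖ * ‖Matrix.toEuclideanCLM (𝕜 := ℝ) A⁻¹‖

end

/-!
On a knot interval `[t_k, t_{k+1}]` both families consist of polynomials of degree `r - 1`, so the
quadratic form of either Gram matrix is a sum over the knot intervals of squared `L²` norms of
polynomials (`dotProduct_gramMatrix_mulVec`). Each interval is rescaled to `[0, 1]`. Only finitely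
many knots enter, so the knot sequence may be assumed to be defined and regular on all of `ℤ`
(`exists_strictMono_extension`).

**B-splines.** Exactly `r` of the B-splines are nonzero on a given knot interval. The condition
number is bounded because, on each interval, the `L²` norm of a spline is comparable to the
Euclidean norm of its `r` coefficients there, with constants that depend on `r` and `M` only
(`exists_local_bounds`, `integral_sq_spline_le`). The upper bound holds since the B-splines are
nonnegative and sum to one. For the lower bound, the `L²` norm controls the coefficients of a
polynomial of bounded degree (`exists_coeff_sq_le_integral`, by compactness), and these control the
B-spline coefficients (`exists_abs_splineCoeff_le`). The latter is an induction on the order: the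
derivative of a spline is a spline of one order less whose coefficients are divided differences of
the original ones (`derivative_sum_bsplinePiece`), so the differences of neighbouring coefficients
are under control, and the value at `t_k`, a convex combination of the coefficients, fixes the rest.

**ReLU powers.** Positive definiteness is linear independence, read off interval by interval: on
`[t_0, t_1]` the `r` active functions are powers of distinct shifts of `X`, which are independent
by the Vandermonde determinant, and each further interval brings in one new function
(`posDef_gramReLU`). The condition number of a positive definite matrix is at least the ratio of
any two of its diagonal entries (`diag_div_diag_le_condNumber`). The function centred at `t_0` is
large on most of `[t_0, t_n]`, while the one centred at `t_{n-1}` lives on a single knot interval,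
and the ratio of their squared norms grows at least linearly in `n` (`le_condNumber_gramReLU`).
-/

section
open Polynomial

/-! ### The polynomial pieces of B-splines -/

/-- The polynomial that agrees with the B-spline `b_i^{[r]}` on the knot interval
`[t_k, t_{k+1})`, by the Cox-de Boor recursion started from the Kronecker delta. -/
noncomputable def bsplinePiece (t : ℤ → ℝ) (k : ℤ) : ℕ → ℤ → ℝ[X]
  | 0, _ => 0
  | 1, i => if i = k then 1 else 0
  | r + 2, i =>
      C (t (i + (r + 1)) - t i)⁻¹ * (X - C (t i)) * bsplinePiece t k (r + 1) i
        + C (t (i + (r + 2)) - t (i + 1))⁻¹ * (C (t (i + (r + 2))) - X)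
          * bsplinePiece t k (r + 1) (i + 1)

theorem bsplinePiece_one (t : ℤ → ℝ) (k i : ℤ) :
    bsplinePiece t k 1 i = if i = k then 1 else 0 := by
  simp [bsplinePiece]

theorem bsplinePiece_succ_succ (t : ℤ → ℝ) (k : ℤ) (r : ℕ) (i : ℤ) :
    bsplinePiece t k (r + 2) i =
      C (t (i + (r + 1)) - t i)⁻¹ * (X - C (t i)) * bsplinePiece t k (r + 1) i
        + C (t (i + (r + 2)) - t (i + 1))⁻¹ * (C (t (i + (r + 2))) - X)
          * bsplinePiece t k (r + 1) (i + 1) := by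
  simp [bsplinePiece]

theorem eval_bsplinePiece {t : ℤ → ℝ} (ht : StrictMono t) {k : ℤ} {x : ℝ}
    (hx : x ∈ Set.Ico (t k) (t (k + 1))) (r : ℕ) (i : ℤ) :
    bspline t r i x = (bsplinePiece t k r i).eval x := by
  induction r using Nat.strong_induction_on generalizing i with
  | _ r ih =>
    match r with
    | 0 => simp [bspline, bsplinePiece]
    | 1 =>
      have : (t i ≤ x ∧ x < t (i + 1)) ↔ i = k := by
        constructor
        · rintro ⟨h1, h2⟩
          have h3 := ht.lt_iff_lt.1 (h1.trans_lt hx.2)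
          have h4 := ht.lt_iff_lt.1 (hx.1.trans_lt h2)
          omega
        · rintro rfl
          exact hx
      simp only [bspline, bsplinePiece_one, this]
      split_ifs <;> simp
    | r + 2 =>
      rw [bspline, bsplinePiece_succ_succ, ih (r + 1) (by omega) i, ih (r + 1) (by omega) (i + 1)]
      simp only [eval_add, eval_mul, eval_C, eval_sub, eval_X]
      ring

theorem bsplinePiece_eq_zero_of_lt (t : ℤ → ℝ) {k i : ℤ} (h : k < i) (s : ℕ) :
    bsplinePiece t k (s + 1) i = 0 := by
  induction s generalizing i with
  | zero => rw [zero_add, bsplinePiece_one, if_neg h.ne']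
  | succ s ih => rw [bsplinePiece_succ_succ, ih h, ih (h.trans (lt_add_one i))]; simp

theorem bsplinePiece_eq_zero_of_add_lt (t : ℤ → ℝ) {k i : ℤ} (s : ℕ) (h : i + s < k) :
    bsplinePiece t k (s + 1) i = 0 := by
  induction s generalizing i with
  | zero => rw [zero_add, bsplinePiece_one, if_neg (by simp at h; omega)]
  | succ s ih =>
    rw [bsplinePiece_succ_succ, ih (by push_cast at h; omega), ih (by push_cast at h; omega)]
    simp

theorem natDegree_bsplinePiece_le (t : ℤ → ℝ) (k : ℤ) (s : ℕ) (i : ℤ) :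
    (bsplinePiece t k (s + 1) i).natDegree ≤ s := by
  induction s generalizing i with
  | zero => rw [zero_add, bsplinePiece_one]; split_ifs <;> simp
  | succ s ih =>
    rw [bsplinePiece_succ_succ]
    have h1 := ih i
    have h2 := ih (i + 1)
    refine natDegree_add_le_of_degree_le ?_ ?_
    · refine natDegree_mul_le.trans ?_
      have : (C (t (i + (s + 1)) - t i)⁻¹ * (X - C (t i))).natDegree ≤ 1 := by
        compute_degree
      omega
    · refine natDegree_mul_le.trans ?_
      have : (C (t (i + (s + 2)) - t (i + 1))⁻¹ * (C (t (i + (s + 2))) - X)).natDegree ≤ 1 := by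
        compute_degree
      omega

theorem eval_bsplinePiece_nonneg {t : ℤ → ℝ} (ht : StrictMono t) {k : ℤ} {x : ℝ}
    (hx : x ∈ Set.Icc (t k) (t (k + 1))) (s : ℕ) (i : ℤ) :
    0 ≤ (bsplinePiece t k (s + 1) i).eval x := by
  induction s generalizing i with
  | zero => rw [zero_add, bsplinePiece_one]; split_ifs <;> simp
  | succ s ih =>
    by_cases h1 : k < i
    · rw [bsplinePiece_eq_zero_of_lt t h1]; simp
    by_cases h2 : i + (s + 1 : ℕ) < k
    · rw [bsplinePiece_eq_zero_of_add_lt t _ h2]; simp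
    rw [bsplinePiece_succ_succ]
    simp only [eval_add, eval_mul, eval_C, eval_sub, eval_X]
    push_cast at h2
    have h3 : t i ≤ t k := ht.monotone (by omega)
    have h4 : t (k + 1) ≤ t (i + (s + 2)) := ht.monotone (by omega)
    have h5 : t i ≤ t (i + (s + 1)) := ht.monotone (by omega)
    have h6 : t (i + 1) ≤ t (i + (s + 2)) := ht.monotone (by omega)
    have := ih i
    have := ih (i + 1)
    have : 0 ≤ x - t i := by linarith [hx.1]
    have : 0 ≤ t (i + (s + 2)) - x := by linarith [hx.2]
    have : 0 ≤ (t (i + (s + 1)) - t i)⁻¹ := inv_nonneg.2 (by linarith)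
    have : 0 ≤ (t (i + (s + 2)) - t (i + 1))⁻¹ := inv_nonneg.2 (by linarith)
    positivity

/-- Summation by parts for sums over the indices of the B-splines that are nonzero on a knot
interval. -/
theorem sum_range_sub_add_shift {R : Type*} [AddCommMonoid R] (A B : ℤ → R) (k : ℤ) (s : ℕ)
    (hA : A (k - (s + 1 : ℕ)) = 0) (hB : B (k + 1) = 0) :
    ∑ j ∈ Finset.range (s + 2), (A (k - j) + B (k - j + 1)) =
      ∑ j ∈ Finset.range (s + 1), (A (k - j) + B (k - j)) := by
  rw [Finset.sum_add_distrib, Finset.sum_add_distrib, Finset.sum_range_succ, hA, add_zero,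
    Finset.sum_range_succ' (fun j : ℕ => B (k - j + 1))]
  simp only [Nat.cast_zero, sub_zero, hB, add_zero]
  congr 1
  refine Finset.sum_congr rfl fun j _ => ?_
  congr 1
  push_cast
  ring

theorem sum_bsplinePiece {t : ℤ → ℝ} (ht : StrictMono t) (k : ℤ) (s : ℕ) :
    ∑ j ∈ Finset.range (s + 1), bsplinePiece t k (s + 1) (k - j) = 1 := by
  induction s with
  | zero => simp [bsplinePiece_one]
  | succ s ih =>
    rw [← ih]
    let A : ℤ → ℝ[X] := fun i =>
      C (t (i + (s + 1)) - t i)⁻¹ * (X - C (t i)) * bsplinePiece t k (s + 1) i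
    let B : ℤ → ℝ[X] := fun i =>
      C (t (i + (s + 1)) - t i)⁻¹ * (C (t (i + (s + 1))) - X) * bsplinePiece t k (s + 1) i
    have hAB := sum_range_sub_add_shift A B k s
      (by simp only [A]; rw [bsplinePiece_eq_zero_of_add_lt t _ (by push_cast; omega), mul_zero])
      (by simp only [B]; rw [bsplinePiece_eq_zero_of_lt t (by omega), mul_zero])
    refine Eq.trans (Finset.sum_congr rfl fun j _ => ?_) (hAB.trans
      (Finset.sum_congr rfl fun j _ => ?_))
    · have : k - j + 1 + ((s : ℤ) + 1) = k - j + (s + 2) := by ring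
      rw [bsplinePiece_succ_succ]
      simp only [A, B, this]
    · have h : (t (k - j + (s + 1)) - t (k - j))⁻¹ * (t (k - j + (s + 1)) - t (k - j)) = 1 :=
        inv_mul_cancel₀ (sub_pos.2 (ht (by omega))).ne'
      have h' := congrArg (C : ℝ → ℝ[X]) h
      simp only [C_mul, C_sub, C_1] at h'
      simp only [A, B]
      linear_combination bsplinePiece t k (s + 1) (k - j) * h'

theorem derivative_bsplinePiece {t : ℤ → ℝ} (ht : StrictMono t) (k : ℤ) (s : ℕ) (i : ℤ) :
    derivative (bsplinePiece t k (s + 2) i) =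
      C ((s : ℝ) + 1) * (C (t (i + (s + 1)) - t i)⁻¹ * bsplinePiece t k (s + 1) i
        - C (t (i + (s + 2)) - t (i + 1))⁻¹ * bsplinePiece t k (s + 1) (i + 1)) := by
  induction s generalizing i with
  | zero =>
    rw [bsplinePiece_succ_succ]
    simp only [zero_add, bsplinePiece_one]
    split_ifs <;> simp
    all_goals ring
  | succ s ih =>
    have e1 : i + 1 + ((s : ℤ) + 1) = i + (s + 2) := by ring
    have e2 : i + 1 + ((s : ℤ) + 2) = i + (s + 3) := by ring
    have e3 : i + (((s + 1 : ℕ) : ℤ) + 1) = i + (s + 2) := by push_cast; ring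
    have e4 : i + (((s + 1 : ℕ) : ℤ) + 2) = i + (s + 3) := by push_cast; ring
    have h1 : (t (i + (s + 2)) - t i)⁻¹ * (t (i + (s + 2)) - t i) = 1 :=
      inv_mul_cancel₀ (sub_pos.2 (ht (by omega))).ne'
    have h2 : (t (i + (s + 3)) - t (i + 1))⁻¹ * (t (i + (s + 3)) - t (i + 1)) = 1 :=
      inv_mul_cancel₀ (sub_pos.2 (ht (by omega))).ne'
    have h1' := congrArg (C : ℝ → ℝ[X]) h1
    have h2' := congrArg (C : ℝ → ℝ[X]) h2
    simp only [C_mul, C_sub, C_1] at h1' h2'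
    rw [bsplinePiece_succ_succ t k (s + 1) i, e3, e4]
    simp only [derivative_add, derivative_mul, derivative_C, derivative_sub, derivative_X,
      zero_mul, zero_add, sub_zero, zero_sub, mul_one]
    rw [ih i, ih (i + 1), bsplinePiece_succ_succ t k s i, bsplinePiece_succ_succ t k s (i + 1),
      e1, e2]
    simp only [Nat.cast_add, Nat.cast_one, C_add, C_1]
    linear_combination (-(C (s : ℝ) + 1) * C (t (i + (s + 2)) - t (i + 1))⁻¹
      * bsplinePiece t k (s + 1) (i + 1)) * (h1' - h2')

/-- The derivative of a spline is a spline of one order less, whose coefficients are divided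
differences of the original ones. -/
theorem derivative_sum_bsplinePiece {t : ℤ → ℝ} (ht : StrictMono t) (k : ℤ) (s : ℕ)
    (c : ℤ → ℝ) :
    derivative (∑ j ∈ Finset.range (s + 2), C (c (k - j)) * bsplinePiece t k (s + 2) (k - j)) =
      ∑ j ∈ Finset.range (s + 1),
        C (((s : ℝ) + 1) * (c (k - j) - c (k - j - 1)) / (t (k - j + (s + 1)) - t (k - j)))
          * bsplinePiece t k (s + 1) (k - j) := by
  let A : ℤ → ℝ[X] := fun i =>
    C (c i * ((s : ℝ) + 1) * (t (i + (s + 1)) - t i)⁻¹) * bsplinePiece t k (s + 1) i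
  let B : ℤ → ℝ[X] := fun i =>
    C (-c (i - 1) * ((s : ℝ) + 1) * (t (i + (s + 1)) - t i)⁻¹) * bsplinePiece t k (s + 1) i
  have hAB := sum_range_sub_add_shift A B k s
    (by simp only [A]; rw [bsplinePiece_eq_zero_of_add_lt t _ (by push_cast; omega), mul_zero])
    (by simp only [B]; rw [bsplinePiece_eq_zero_of_lt t (by omega), mul_zero])
  rw [derivative_sum]
  refine Eq.trans (Finset.sum_congr rfl fun j _ => ?_) (hAB.trans
    (Finset.sum_congr rfl fun j _ => ?_))
  · have e : k - j + 1 + ((s : ℤ) + 1) = k - j + (s + 2) := by ring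
    rw [derivative_C_mul, derivative_bsplinePiece ht]
    simp only [A, B, e, add_sub_cancel_right, C_mul, C_neg]
    ring
  · simp only [A, B, ← add_mul, ← C_add]
    congr 2
    ring

theorem eval_bsplinePiece_le_one {t : ℤ → ℝ} (ht : StrictMono t) {k : ℤ} {x : ℝ}
    (hx : x ∈ Set.Icc (t k) (t (k + 1))) {s j : ℕ} (hj : j ∈ Finset.range (s + 1)) :
    (bsplinePiece t k (s + 1) (k - j)).eval x ≤ 1 := by
  have h := congrArg (eval x) (sum_bsplinePiece ht k s)
  rw [eval_finsetSum, eval_one] at h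
  rw [← h]
  exact Finset.single_le_sum (f := fun j : ℕ => (bsplinePiece t k (s + 1) (k - j)).eval x)
    (fun j _ => eval_bsplinePiece_nonneg ht hx s _) hj


/-! ### Norms of polynomials on the unit interval -/

/-- On polynomials of degree at most `d`, the `L²` norm on `[0, 1]` controls the coefficients:
the quadratic form `∫ q²` is positive definite on a finite-dimensional space, so it has a positive
minimum on the unit sphere. -/
theorem exists_coeff_sq_le_integral (d : ℕ) :
    ∃ K : ℝ, 0 < K ∧ ∀ q : ℝ[X], q.natDegree ≤ d →
      ∀ m, q.coeff m ^ 2 ≤ K * ∫ y in (0 : ℝ)..1, q.eval y ^ 2 := by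
  let p : (Fin (d + 1) → ℝ) → ℝ[X] := fun a => ∑ i, C (a i) * X ^ (i : ℕ)
  let F : (Fin (d + 1) → ℝ) → ℝ := fun a => ∫ y in (0 : ℝ)..1, (∑ i, a i * y ^ (i : ℕ)) ^ 2
  have hF : ∀ a, F a = ∫ y in (0 : ℝ)..1, (p a).eval y ^ 2 := by
    intro a
    simp only [F, p, eval_finsetSum, eval_mul, eval_C, eval_pow, eval_X]
  have hcont : Continuous F := by
    refine intervalIntegral.continuous_parametric_intervalIntegral_of_continuous' ?_ _ _
    unfold Function.uncurry
    fun_prop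
  have hcoeff : ∀ a (i : Fin (d + 1)), (p a).coeff i = a i := by
    intro a i
    simp only [p, finsetSum_coeff, coeff_C_mul, coeff_X_pow]
    rw [Finset.sum_eq_single i]
    · simp
    · intro j _ hj
      rw [if_neg (fun h => hj (Fin.ext h.symm)), mul_zero]
    · simp
  have hpos : ∀ a, a ≠ 0 → 0 < F a := by
    intro a ha
    have hp : p a ≠ 0 := by
      intro h
      refine ha (funext fun i => ?_)
      rw [← hcoeff a i, h]
      simp
    rw [hF]
    refine intervalIntegral.integral_pos one_pos (by fun_prop) (fun _ _ => sq_nonneg _) ?_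
    by_contra! hcon
    refine hp (eq_zero_of_infinite_isRoot _ ((Set.Icc_infinite (zero_lt_one (α := ℝ))).mono ?_))
    intro x hx
    exact pow_eq_zero_iff two_ne_zero |>.1 (le_antisymm (hcon x hx) (sq_nonneg _))
  obtain ⟨a₀, ha₀, hmin⟩ := (isCompact_sphere (0 : Fin (d + 1) → ℝ) 1).exists_isMinOn
    (NormedSpace.sphere_nonempty.2 zero_le_one) hcont.continuousOn
  have hα : 0 < F a₀ := hpos a₀ (ne_zero_of_mem_unit_sphere ⟨a₀, ha₀⟩)
  refine ⟨(F a₀)⁻¹, inv_pos.2 hα, fun q hq m => ?_⟩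
  have hint : 0 ≤ ∫ y in (0 : ℝ)..1, q.eval y ^ 2 :=
    intervalIntegral.integral_nonneg zero_le_one fun _ _ => sq_nonneg _
  by_cases hm : q.coeff m = 0
  · rw [hm, zero_pow two_ne_zero]
    exact mul_nonneg (inv_nonneg.2 hα.le) hint
  have hmd : m < d + 1 := by
    have := le_natDegree_of_ne_zero hm
    omega
  let a : Fin (d + 1) → ℝ := fun i => q.coeff i
  have hqa : p a = q := by
    conv_rhs => rw [q.as_sum_range_C_mul_X_pow' (n := d + 1) (by omega)]
    exact Fin.sum_univ_eq_sum_range (fun i => C (q.coeff i) * X ^ i) (d + 1)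
  have ha : a ≠ 0 := fun h => hm (congrFun h ⟨m, hmd⟩)
  have hn : 0 < ‖a‖ := norm_pos_iff.2 ha
  have hs : ‖a‖⁻¹ • a ∈ Metric.sphere (0 : Fin (d + 1) → ℝ) 1 := by
    rw [mem_sphere_zero_iff_norm, norm_smul, norm_inv, norm_norm, inv_mul_cancel₀ hn.ne']
  have h1 : F a₀ ≤ F (‖a‖⁻¹ • a) := hmin hs
  have h2 : F (‖a‖⁻¹ • a) = ‖a‖⁻¹ ^ 2 * F a := by
    simp only [F, Pi.smul_apply, smul_eq_mul, mul_assoc, ← Finset.mul_sum, mul_pow,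
      intervalIntegral.integral_const_mul]
  rw [h2, hF a, hqa] at h1
  have h3 : |q.coeff m| ≤ ‖a‖ := norm_le_pi_norm a ⟨m, hmd⟩
  have h4 : q.coeff m ^ 2 ≤ ‖a‖ ^ 2 := sq_le_sq.2 (by rwa [abs_norm])
  rw [inv_mul_eq_div, le_div_iff₀ hα]
  calc q.coeff m ^ 2 * F a₀ ≤ ‖a‖ ^ 2 * (‖a‖⁻¹ ^ 2 * ∫ y in (0 : ℝ)..1, q.eval y ^ 2) :=
        mul_le_mul h4 h1 hα.le (sq_nonneg _)
    _ = _ := by field_simp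

/-- The polynomial `p`, seen on the knot interval `[t_k, t_{k+1}]` rescaled to `[0, 1]`. -/
noncomputable def rescaleToUnit (t : ℤ → ℝ) (k : ℤ) (p : ℝ[X]) : ℝ[X] :=
  p.comp (C (t (k + 1) - t k) * X + C (t k))

theorem eval_rescaleToUnit (t : ℤ → ℝ) (k : ℤ) (p : ℝ[X]) (y : ℝ) :
    (rescaleToUnit t k p).eval y = p.eval ((t (k + 1) - t k) * y + t k) := by
  simp [rescaleToUnit, eval_comp]

theorem natDegree_rescaleToUnit_le (t : ℤ → ℝ) (k : ℤ) (p : ℝ[X]) :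
    (rescaleToUnit t k p).natDegree ≤ p.natDegree := by
  refine natDegree_comp_le.trans ?_
  exact (Nat.mul_le_mul_left _ natDegree_linear_le).trans_eq (mul_one _)

theorem add_mem_Icc_of_mem_unit {t : ℤ → ℝ} (ht : StrictMono t) (k : ℤ) {y : ℝ}
    (hy : y ∈ Set.Icc (0 : ℝ) 1) :
    (t (k + 1) - t k) * y + t k ∈ Set.Icc (t k) (t (k + 1)) := by
  have := ht (lt_add_one k)
  constructor <;> nlinarith [hy.1, hy.2]

/-! ### Control of the B-spline coefficients by the polynomial -/

theorem natDegree_sum_bsplinePiece_le (t : ℤ → ℝ) (k : ℤ) (s : ℕ) (c : ℤ → ℝ) :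
    (∑ j ∈ Finset.range (s + 1), C (c (k - j)) * bsplinePiece t k (s + 1) (k - j)).natDegree
      ≤ s :=
  natDegree_sum_le_of_forall_le _ _ fun _ _ =>
    (natDegree_C_mul_le _ _).trans (natDegree_bsplinePiece_le _ _ _ _)

theorem sub_le_of_spacing {t : ℤ → ℝ} {M : ℝ}
    (hM : ∀ i j, t (i + 1) - t i ≤ M * (t (j + 1) - t j)) (k i : ℤ) (s : ℕ) :
    t (i + s) - t i ≤ s * (M * (t (k + 1) - t k)) := by
  induction s with
  | zero => simp
  | succ s ih =>
    have h := hM (i + s) k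
    push_cast
    rw [← add_assoc]
    linarith

/-- The B-spline coefficients that matter on one knot interval are bounded by the polynomial
coefficients of the rescaled spline, uniformly in the knots. By induction on the order: the
differences of the coefficients are, up to bounded factors, the B-spline coefficients of the
derivative, and since the B-splines sum to one, the value at the left end then determines the
coefficients themselves. -/
theorem exists_abs_splineCoeff_le (M : ℝ) (s : ℕ) :
    ∃ K : ℝ, 0 < K ∧ ∀ t : ℤ → ℝ, StrictMono t →
      (∀ i j, t (i + 1) - t i ≤ M * (t (j + 1) - t j)) → ∀ (k : ℤ) (c : ℤ → ℝ) (ε : ℝ),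
      (∀ m, |(rescaleToUnit t k (∑ j ∈ Finset.range (s + 1),
        C (c (k - j)) * bsplinePiece t k (s + 1) (k - j))).coeff m| ≤ ε) →
      ∀ j ∈ Finset.range (s + 1), |c (k - j)| ≤ K * ε := by
  induction s with
  | zero =>
    refine ⟨1, one_pos, fun t ht hM k c ε h j hj => ?_⟩
    obtain rfl : j = 0 := by simpa using hj
    have := h 0
    simpa [bsplinePiece_one, rescaleToUnit] using this
  | succ s ih =>
    obtain ⟨K, hK, ih⟩ := ih
    refine ⟨1 + 2 * ((s + 1) * (K * (s + 1) * |M|)), by positivity,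
      fun t ht hM k c ε h j hj => ?_⟩
    have hε : 0 ≤ ε := (abs_nonneg _).trans (h 0)
    have hℓ : 0 < t (k + 1) - t k := sub_pos.2 (ht (lt_add_one k))
    set ℓ := t (k + 1) - t k with hℓ_def
    set p := ∑ j ∈ Finset.range (s + 2), C (c (k - j)) * bsplinePiece t k (s + 2) (k - j)
      with hp
    let e : ℤ → ℝ := fun i => ℓ * (((s : ℝ) + 1) * (c i - c (i - 1)) / (t (i + (s + 1)) - t i))
    have hder : derivative (rescaleToUnit t k p) = rescaleToUnit t k
        (∑ j ∈ Finset.range (s + 1), C (e (k - j)) * bsplinePiece t k (s + 1) (k - j)) := by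
      rw [rescaleToUnit, derivative_comp, derivative_sum_bsplinePiece ht]
      simp only [derivative_add, derivative_C_mul, derivative_X, derivative_C, mul_one, add_zero,
        rescaleToUnit, e, C_mul (a := ℓ), mul_assoc, ← Finset.mul_sum, mul_comp, C_comp,
        ← hℓ_def]
    -- The coefficients of the derivative exceed those of the polynomial by a factor at most the
    -- degree.
    have hcoeff : ∀ m, |(rescaleToUnit t k (∑ j ∈ Finset.range (s + 1),
        C (e (k - j)) * bsplinePiece t k (s + 1) (k - j))).coeff m| ≤ (s + 1) * ε := by
      intro m
      rw [← hder, coeff_derivative]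
      by_cases hm : m + 1 ≤ s + 1
      · rw [abs_mul, mul_comm]
        have h0 : |(m : ℝ) + 1| ≤ s + 1 := by
          rw [abs_of_nonneg (by positivity)]
          exact_mod_cast hm
        exact mul_le_mul h0 (h (m + 1)) (abs_nonneg _) (by positivity)
      · have h0 : (rescaleToUnit t k p).natDegree ≤ s + 1 :=
          (natDegree_rescaleToUnit_le t k p).trans (natDegree_sum_bsplinePiece_le t k (s + 1) c)
        rw [coeff_eq_zero_of_natDegree_lt (by omega), zero_mul, abs_zero]
        positivity
    have he := ih t ht hM k e _ hcoeff
    set D := K * (s + 1) * |M| * ε with hD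
    have hD0 : 0 ≤ D := by positivity
    have hdiff : ∀ j ∈ Finset.range (s + 1), |c (k - j) - c (k - j - 1)| ≤ D := by
      intro j hj
      have h1 := he j hj
      have h2 : 0 < t (k - j + (s + 1)) - t (k - j) := sub_pos.2 (ht (by omega))
      have h3 : t (k - j + (s + 1)) - t (k - j) ≤ ((s : ℝ) + 1) * (|M| * ℓ) := by
        have := sub_le_of_spacing hM k (k - j) (s + 1)
        push_cast at this
        refine this.trans ?_
        gcongr
        exact le_abs_self M
      have h4 : c (k - j) - c (k - j - 1) =
          e (k - j) * ((t (k - j + (s + 1)) - t (k - j)) / (ℓ * (s + 1))) := by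
        have : (s : ℝ) + 1 ≠ 0 := by positivity
        simp only [e]
        field_simp
      rw [h4, abs_mul, abs_of_nonneg (a := _ / _) (by positivity)]
      calc |e (k - j)| * ((t (k - j + (s + 1)) - t (k - j)) / (ℓ * (s + 1)))
          ≤ (K * ((s + 1) * ε)) * ((((s : ℝ) + 1) * (|M| * ℓ)) / (ℓ * (s + 1))) := by gcongr
        _ = D := by rw [hD]; field_simp
    have hfar : ∀ j ∈ Finset.range (s + 2), |c (k - j) - c k| ≤ (s + 1) * D := by
      have h0 : ∀ j : ℕ, j < s + 2 → |c (k - j) - c k| ≤ j * D := by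
        intro j
        induction j with
        | zero => simp
        | succ j ihj =>
          intro hj
          have h1 := ihj (by omega)
          have h2 := hdiff j (Finset.mem_range.2 (by omega))
          rw [abs_sub_comm] at h2
          have h3 := abs_add_le (c (k - j - 1) - c (k - j)) (c (k - j) - c k)
          rw [sub_add_sub_cancel] at h3
          push_cast
          rw [← sub_sub]
          linarith
      intro j hj
      have hj' := Finset.mem_range.1 hj
      refine (h0 j hj').trans ?_
      have : (j : ℝ) ≤ s + 1 := by exact_mod_cast Nat.lt_succ_iff.1 hj'
      gcongr
    have hck : |c k| ≤ ε + (s + 1) * D := by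
      have hmem : t k ∈ Set.Icc (t k) (t (k + 1)) := ⟨le_rfl, (ht (lt_add_one k)).le⟩
      have h0 : p.eval (t k) = (rescaleToUnit t k p).coeff 0 := by
        rw [coeff_zero_eq_eval_zero, eval_rescaleToUnit, mul_zero, zero_add]
      have h1 := congrArg (eval (t k)) (sum_bsplinePiece ht k (s + 1))
      rw [eval_finsetSum, eval_one] at h1
      have h2 : c k = p.eval (t k) - ∑ j ∈ Finset.range (s + 2),
          (c (k - j) - c k) * (bsplinePiece t k (s + 2) (k - j)).eval (t k) := by
        simp only [hp, eval_finsetSum, eval_mul, eval_C, sub_mul, Finset.sum_sub_distrib]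
        rw [← Finset.mul_sum, h1]
        ring
      have h3 : |∑ j ∈ Finset.range (s + 2),
          (c (k - j) - c k) * (bsplinePiece t k (s + 2) (k - j)).eval (t k)| ≤ (s + 1) * D := by
        refine (Finset.abs_sum_le_sum_abs _ _).trans ?_
        calc _ ≤ ∑ j ∈ Finset.range (s + 2),
              ((s + 1) * D) * (bsplinePiece t k (s + 2) (k - j)).eval (t k) := by
              refine Finset.sum_le_sum fun j hj => ?_
              have h5 := eval_bsplinePiece_nonneg ht hmem (s + 1) (k - j)
              rw [abs_mul, abs_of_nonneg h5]
              exact mul_le_mul_of_nonneg_right (hfar j hj) h5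
          _ = (s + 1) * D := by rw [← Finset.mul_sum, h1, mul_one]
      rw [h2]
      refine (abs_sub _ _).trans (add_le_add ?_ h3)
      rw [h0]
      exact h 0
    have h6 := abs_add_le (c (k - j) - c k) (c k)
    rw [sub_add_cancel] at h6
    have h7 := hfar j hj
    calc |c (k - j)| ≤ ε + 2 * ((s + 1) * D) := by linarith
      _ = _ := by rw [hD]; ring

end

/-! ### Condition numbers of symmetric matrices -/

section
open Matrix WithLp
variable {ι : Type*} [Fintype ι]

theorem norm_sq_eq_dotProduct (v : EuclideanSpace ℝ ι) : ‖v‖ ^ 2 = ofLp v ⬝ᵥ ofLp v := by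
  rw [EuclideanSpace.norm_sq_eq]
  simp [dotProduct, sq]

theorem dotProduct_mulVec_comm_of_isHermitian {A : Matrix ι ι ℝ} (hA : A.IsHermitian)
    (x y : ι → ℝ) : x ⬝ᵥ A *ᵥ y = y ⬝ᵥ A *ᵥ x := by
  have hT : Aᵀ = A := by rw [← conjTranspose_eq_transpose_of_trivial]; exact hA
  rw [dotProduct_mulVec, ← mulVec_transpose, hT, dotProduct_comm]

variable [DecidableEq ι]

theorem norm_toEuclideanCLM_le {A : Matrix ι ι ℝ} (hA : A.IsHermitian) {β : ℝ} (hβ : 0 < β)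
    (h0 : ∀ x : ι → ℝ, 0 ≤ x ⬝ᵥ A *ᵥ x) (h1 : ∀ x : ι → ℝ, x ⬝ᵥ A *ᵥ x ≤ β * (x ⬝ᵥ x)) :
    ‖Matrix.toEuclideanCLM (𝕜 := ℝ) A‖ ≤ β := by
  refine ContinuousLinearMap.opNorm_le_bound _ hβ.le fun x => ?_
  refine (abs_le_of_sq_le_sq' ?_ (by positivity)).2
  rw [mul_pow, norm_sq_eq_dotProduct, norm_sq_eq_dotProduct, ofLp_toEuclideanCLM]
  set u := ofLp x
  -- Polarisation, with the vectors `u` and `y = β⁻¹ A u`.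
  set y := β⁻¹ • A *ᵥ u with hy
  have hsymm : u ⬝ᵥ A *ᵥ y = y ⬝ᵥ A *ᵥ u := dotProduct_mulVec_comm_of_isHermitian hA u y
  have h2 := h1 (u + y)
  have h3 := h0 (u - y)
  simp only [mulVec_add, mulVec_sub, add_dotProduct, dotProduct_add, sub_dotProduct,
    dotProduct_sub, hsymm, dotProduct_comm y u] at h2 h3
  have h4 : β * (y ⬝ᵥ y) = y ⬝ᵥ A *ᵥ u := by
    conv_lhs => rw [hy, dotProduct_smul, smul_eq_mul, ← hy]
    field_simp
  have h5 : A *ᵥ u ⬝ᵥ A *ᵥ u = β * (y ⬝ᵥ A *ᵥ u) := by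
    rw [hy, smul_dotProduct, smul_eq_mul]
    field_simp
  have h6 : 0 ≤ β * ((u - y) ⬝ᵥ (u - y)) :=
    mul_nonneg hβ.le (Finset.sum_nonneg fun i _ => mul_self_nonneg _)
  simp only [sub_dotProduct, dotProduct_sub, dotProduct_comm y u] at h6
  rw [h5, sq, mul_assoc]
  refine mul_le_mul_of_nonneg_left ?_ hβ.le
  linarith

/-- Two-sided bounds on the Rayleigh quotient bound the condition number. -/
theorem posDef_and_condNumber_le {A : Matrix ι ι ℝ} (hA : A.IsHermitian) {α β : ℝ} (hα : 0 < α)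
    (hβ : 0 < β) (h0 : ∀ x : ι → ℝ, α * (x ⬝ᵥ x) ≤ x ⬝ᵥ A *ᵥ x)
    (h1 : ∀ x : ι → ℝ, x ⬝ᵥ A *ᵥ x ≤ β * (x ⬝ᵥ x)) :
    A.PosDef ∧ condNumber A ≤ β / α := by
  have hnn : ∀ x : ι → ℝ, 0 ≤ x ⬝ᵥ x := fun x => Finset.sum_nonneg fun i _ => mul_self_nonneg _
  have hpd : A.PosDef := by
    refine posDef_iff_dotProduct_mulVec.2 ⟨hA, fun x hx => ?_⟩
    rw [star_trivial]
    refine lt_of_lt_of_le (mul_pos hα ((hnn x).lt_of_ne' ?_)) (h0 x)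
    exact fun h => hx (dotProduct_self_eq_zero.1 h)
  refine ⟨hpd, ?_⟩
  have hinv : ‖Matrix.toEuclideanCLM (𝕜 := ℝ) A⁻¹‖ ≤ α⁻¹ := by
    refine ContinuousLinearMap.opNorm_le_bound _ (inv_pos.2 hα).le fun x => ?_
    set z := Matrix.toEuclideanCLM (𝕜 := ℝ) A⁻¹ x with hz
    have hAz : Matrix.toEuclideanCLM (𝕜 := ℝ) A z = x := by
      have := hpd.isUnit
      rw [hz, ← mul_apply_eq_comp, ← map_mul,
        mul_nonsing_inv _ ((isUnit_iff_isUnit_det _).1 this), map_one]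
      rfl
    have h2 := h0 (ofLp z)
    rw [← inner_toEuclideanCLM, hAz, ← norm_sq_eq_dotProduct] at h2
    have h3 := h2.trans (real_inner_le_norm z x)
    rw [inv_mul_eq_div, le_div_iff₀ hα]
    rcases (norm_nonneg z).eq_or_lt with h | h
    · rw [← h, zero_mul]
      exact norm_nonneg x
    · refine le_of_mul_le_mul_left ?_ h
      linarith
  rw [condNumber, div_eq_mul_inv]
  exact mul_le_mul (norm_toEuclideanCLM_le hA hβ
    (fun x => (mul_nonneg hα.le (hnn x)).trans (h0 x)) h1) hinv (norm_nonneg _) hβ.le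

theorem diag_le_norm_toEuclideanCLM (A : Matrix ι ι ℝ) (i : ι) :
    A i i ≤ ‖Matrix.toEuclideanCLM (𝕜 := ℝ) A‖ := by
  let e : EuclideanSpace ℝ ι := toLp 2 (Pi.single i 1)
  have he : ‖e‖ = 1 := by simp [e]
  have h1 : inner ℝ e (Matrix.toEuclideanCLM (𝕜 := ℝ) A e) = A i i := by
    rw [inner_toEuclideanCLM]
    simp [e]
  rw [← h1]
  refine (real_inner_le_norm _ _).trans ?_
  rw [he, one_mul]
  simpa [he] using (Matrix.toEuclideanCLM (𝕜 := ℝ) A).le_opNorm e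

/-- The condition number is at least the ratio of any two diagonal entries. -/
theorem diag_div_diag_le_condNumber {A : Matrix ι ι ℝ} (hA : A.PosDef) (i j : ι) :
    A i i / A j j ≤ condNumber A := by
  have hdet : IsUnit A.det := (isUnit_iff_isUnit_det _).1 hA.isUnit
  have hj : 0 < A j j := hA.diag_pos
  have h1 : (A j j)⁻¹ ≤ A⁻¹ j j := by
    let e : ι → ℝ := Pi.single j 1
    -- Positivity of the quadratic form at `A⁻¹ eⱼ - (Aⱼⱼ)⁻¹ eⱼ`.
    have h2 := hA.posSemidef.dotProduct_mulVec_nonneg (A⁻¹ *ᵥ e - (A j j)⁻¹ • e)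
    have h3 : A *ᵥ (A⁻¹ *ᵥ e) = e := by rw [mulVec_mulVec, mul_nonsing_inv _ hdet, one_mulVec]
    have h4 := dotProduct_mulVec_comm_of_isHermitian hA.isHermitian (A⁻¹ *ᵥ e) e
    have h5 : e ⬝ᵥ A *ᵥ e = A j j := by simp [e]
    have h6 : A⁻¹ *ᵥ e ⬝ᵥ e = A⁻¹ j j := by simp [e]
    have h7 : e ⬝ᵥ e = 1 := by simp [e]
    rw [h3, h7] at h4
    simp only [star_trivial, mulVec_sub, mulVec_smul, h3, sub_dotProduct, dotProduct_sub,
      smul_dotProduct, dotProduct_smul, h4, h5, h6, h7, smul_eq_mul] at h2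
    rw [inv_mul_cancel₀ hj.ne'] at h2
    linarith
  rw [condNumber, div_eq_mul_inv]
  exact mul_le_mul (diag_le_norm_toEuclideanCLM A i)
    (h1.trans (diag_le_norm_toEuclideanCLM A⁻¹ j)) (inv_pos.2 hj).le (norm_nonneg _)

end

section
open Polynomial

/-! ### Extension of the knot sequence -/

/-- A knot sequence extends to a strictly increasing sequence on all of `ℤ` with the same bound on
the ratios of the spacings: continue it on both sides with one of its own spacings. -/
theorem exists_strictMono_extension {r n : ℕ} (hr : 1 ≤ r) (hn : 1 ≤ n) {t : ℤ → ℝ} {M : ℝ}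
    (ht : IsKnotSequence r n t) (hM : SpacingRatioLE r n t M) :
    ∃ u : ℤ → ℝ, StrictMono u ∧ (∀ i j, u (i + 1) - u i ≤ M * (u (j + 1) - u j)) ∧
      ∀ i ∈ Set.Icc (1 - (r : ℤ)) ((n : ℤ) + r - 1), t i = u i := by
  set lo : ℤ := 1 - (r : ℤ) with hlo
  set hi : ℤ := (n : ℤ) + r - 1 with hhi
  have hlt : lo < hi := by omega
  let u : ℤ → ℝ := fun i =>
    t (max lo (min i hi)) + (t (lo + 1) - t lo) * ((i - max lo (min i hi) : ℤ) : ℝ)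
  have hstep : ∀ i, ∃ j ∈ Set.Ico lo hi, u (i + 1) - u i = t (j + 1) - t j := by
    intro i
    rcases lt_or_ge i lo with h | h
    · refine ⟨lo, ⟨le_rfl, hlt⟩, ?_⟩
      simp only [u]
      rw [show max lo (min (i + 1) hi) = lo by omega, show max lo (min i hi) = lo by omega]
      push_cast
      ring
    rcases lt_or_ge i hi with h' | h'
    · refine ⟨i, ⟨h, h'⟩, ?_⟩
      simp only [u]
      rw [show max lo (min (i + 1) hi) = i + 1 by omega, show max lo (min i hi) = i by omega]
      simp
    · refine ⟨lo, ⟨le_rfl, hlt⟩, ?_⟩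
      simp only [u]
      rw [show max lo (min (i + 1) hi) = hi by omega, show max lo (min i hi) = hi by omega]
      push_cast
      ring
  refine ⟨u, strictMono_int_of_lt_succ fun i => ?_, fun i j => ?_, fun i hi' => ?_⟩
  · obtain ⟨j, hj, h⟩ := hstep i
    have : t j < t (j + 1) := ht ⟨hj.1, hj.2.le⟩ ⟨by linarith [hj.1], hj.2⟩ (lt_add_one j)
    linarith
  · obtain ⟨i', hi', h⟩ := hstep i
    obtain ⟨j', hj', h'⟩ := hstep j
    rw [h, h']
    exact hM i' hi' j' hj'
  · have h : max lo (min i hi) = i := by rw [min_eq_left hi'.2, max_eq_right hi'.1]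
    simp only [u]
    rw [h, sub_self, Int.cast_zero, mul_zero, add_zero]

theorem bspline_congr {t u : ℤ → ℝ} (r : ℕ) (i : ℤ)
    (h : ∀ j, i ≤ j → j ≤ i + r → t j = u j) : bspline t r i = bspline u r i := by
  induction r using Nat.strong_induction_on generalizing i with
  | _ r ih =>
    match r with
    | 0 => rfl
    | 1 =>
      ext x
      rw [bspline, bspline, h i le_rfl (by simp), h (i + 1) (by simp) (by simp)]
    | r + 2 =>
      have h1 := ih (r + 1) (by omega) i fun j h1 h2 => h j h1 (by push_cast at h2 ⊢; omega)
      have h2 := ih (r + 1) (by omega) (i + 1)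
        fun j h1 h2 => h j (by omega) (by push_cast at h2 ⊢; omega)
      ext x
      rw [bspline, bspline, h1, h2, h i le_rfl (by omega), h (i + 1) (by omega) (by omega),
        h (i + (r + 1)) (by omega) (by push_cast; omega), h (i + (r + 2)) (by omega) (by simp)]

theorem gramSpline_congr {r n : ℕ} (hr : 1 ≤ r) {t u : ℤ → ℝ}
    (h : ∀ i ∈ Set.Icc (1 - (r : ℤ)) ((n : ℤ) + r - 1), t i = u i) :
    gramSpline r n t = gramSpline r n u := by
  rw [gramSpline, gramSpline, h 0 (by constructor <;> omega), h n (by constructor <;> omega)]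
  congr 1
  ext i : 1
  have hi := Finset.mem_Icc.1 i.2
  exact bspline_congr r i fun j h1 h2 => h j ⟨by omega, by omega⟩

theorem gramReLU_congr {r n : ℕ} (hr : 1 ≤ r) {t u : ℤ → ℝ}
    (h : ∀ i ∈ Set.Icc (1 - (r : ℤ)) ((n : ℤ) + r - 1), t i = u i) :
    gramReLU r n t = gramReLU r n u := by
  rw [gramReLU, gramReLU, h 0 (by constructor <;> omega), h n (by constructor <;> omega)]
  congr 1
  ext i : 1
  have hi := Finset.mem_Icc.1 i.2
  funext x
  rw [reluPow, reluPow, h i ⟨by omega, by omega⟩]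

/-! ### Gram matrices of piecewise polynomials -/

theorem gramMatrix_isHermitian {ι : Type*} (a b : ℝ) (φ : ι → ℝ → ℝ) :
    (gramMatrix a b φ).IsHermitian := by
  ext i j
  simp [gramMatrix, mul_comm]

theorem gramMatrix_apply {ι : Type*} {a b : ℝ} (hab : a ≤ b) (φ : ι → ℝ → ℝ) (i j : ι) :
    gramMatrix a b φ i j = (b - a)⁻¹ * ∫ x in a..b, φ i x * φ j x := by
  rw [gramMatrix, Matrix.of_apply, ProbabilityTheory.cond, integral_smul_measure,
    intervalIntegral.integral_of_le hab, integral_Icc_eq_integral_Ioc, Real.volume_Icc,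
    ENNReal.toReal_inv, ENNReal.toReal_ofReal (sub_nonneg.2 hab), smul_eq_mul]

/-- The quadratic form of the Gram matrix of functions that are polynomial on each knot interval:
a sum over the knot intervals, each of them rescaled to `[0, 1]`. -/
theorem dotProduct_gramMatrix_mulVec {ι : Type*} [Fintype ι] {t : ℤ → ℝ} (ht : StrictMono t)
    (n : ℕ) (φ : ι → ℝ → ℝ) (P : ℤ → ι → ℝ[X])
    (hP : ∀ (k : ℤ) (i : ι), ∀ x ∈ Set.Ico (t k) (t (k + 1)), φ i x = (P k i).eval x)
    (c : ι → ℝ) :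
    dotProduct c ((gramMatrix (t 0) (t n) φ).mulVec c) =
      (t n - t 0)⁻¹ * ∑ k ∈ Finset.range n, (t (k + 1) - t k) *
        ∫ y in (0 : ℝ)..1, (rescaleToUnit t k (∑ i, C (c i) * P k i)).eval y ^ 2 := by
  have hpiece : ∀ (k : ℕ) (i j : ι), ∀ x ∈ Set.Ioo (t k) (t (k + 1)),
      (P k i * P k j).eval x = φ i x * φ j x := by
    intro k i j x hx
    rw [eval_mul, hP k i x ⟨hx.1.le, hx.2⟩, hP k j x ⟨hx.1.le, hx.2⟩]
  have hle : ∀ k : ℤ, t k ≤ t (k + 1) := fun k => (ht (lt_add_one k)).le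
  have hentry : ∀ i j, gramMatrix (t 0) (t n) φ i j = (t n - t 0)⁻¹ *
      ∑ k ∈ Finset.range n, ∫ x in (t k)..(t (k + 1)), (P k i * P k j).eval x := by
    intro i j
    rw [gramMatrix_apply (ht.monotone (by omega))]
    have hint : ∀ k < n, IntervalIntegrable (fun x => φ i x * φ j x) volume
        (t ((k : ℕ) : ℤ)) (t ((k + 1 : ℕ) : ℤ)) := by
      intro k _
      push_cast
      refine IntervalIntegrable.congr_uIoo
        ((P k i * P k j).continuous.intervalIntegrable (μ := volume) _ _) ?_
      rw [Set.uIoo_of_le (hle k)]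
      exact hpiece k i j
    have := intervalIntegral.sum_integral_adjacent_intervals (a := fun k : ℕ => t (k : ℤ)) hint
    rw [Nat.cast_zero] at this
    rw [← this]
    congr 1
    refine Finset.sum_congr rfl fun k _ => ?_
    push_cast
    exact (intervalIntegral.integral_congr_Ioo_of_le (hle k) (hpiece k i j)).symm
  have hk : ∀ k : ℤ, (t (k + 1) - t k) *
      ∫ y in (0 : ℝ)..1, (rescaleToUnit t k (∑ i, C (c i) * P k i)).eval y ^ 2 =
      ∑ i, ∑ j, c i * c j * ∫ x in (t k)..(t (k + 1)), (P k i * P k j).eval x := by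
    intro k
    simp only [eval_rescaleToUnit]
    have := intervalIntegral.mul_integral_comp_mul_add (a := 0) (b := 1)
      (f := fun x => (∑ i, C (c i) * P k i).eval x ^ 2) (t (k + 1) - t k) (t k)
    rw [this, mul_zero, zero_add, mul_one, sub_add_cancel]
    simp only [← intervalIntegral.integral_const_mul]
    rw [← Finset.sum_congr rfl fun i _ => intervalIntegral.integral_finsetSum
        fun j _ => Continuous.intervalIntegrable (by fun_prop) _ _,
      ← intervalIntegral.integral_finsetSum
        fun j _ => Continuous.intervalIntegrable (by fun_prop) _ _]
    refine intervalIntegral.integral_congr fun x _ => ?_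
    simp only [eval_finsetSum, eval_mul, eval_C, sq, Finset.sum_mul_sum]
    exact Finset.sum_congr rfl fun i _ => Finset.sum_congr rfl fun j _ => by ring
  simp only [dotProduct, Matrix.mulVec, hentry, hk, Finset.mul_sum, Finset.sum_mul]
  rw [Finset.sum_comm' (s := Finset.range n) (t' := Finset.univ) (s' := fun _ => Finset.range n)
    (by simp)]
  refine Finset.sum_congr rfl fun i _ => ?_
  rw [Finset.sum_comm]
  exact Finset.sum_congr rfl fun k _ => Finset.sum_congr rfl fun j _ => by ring

/-! ### Reindexing by knot intervals -/

/-- A family indexed by the basis functions, extended by zero to all integers. -/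
noncomputable def extendByZero {r n : ℕ} (c : BasisIndex r n → ℝ) (i : ℤ) : ℝ :=
  if h : i ∈ Finset.Icc (1 - (r : ℤ)) ((n : ℤ) - 1) then c ⟨i, h⟩ else 0

theorem extendByZero_coe {r n : ℕ} (c : BasisIndex r n → ℝ) (i : BasisIndex r n) :
    extendByZero c i = c i := by
  rw [extendByZero, dif_pos i.2]

/-- A combination of piecewise polynomials, on the knot interval `[t_k, t_{k+1})`, when only the
functions with indices `k - s, …, k` are nonzero there. -/
theorem sum_basisIndex_eq_sum_range {s n : ℕ} {k : ℤ} (hk0 : 0 ≤ k) (hkn : k < n)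
    (c : BasisIndex (s + 1) n → ℝ) (P : ℤ → ℝ[X])
    (h1 : ∀ i ∈ Finset.Icc (-(s : ℤ)) (n - 1), k < i → P i = 0)
    (h2 : ∀ i ∈ Finset.Icc (-(s : ℤ)) (n - 1), i + s < k → P i = 0) :
    ∑ i : BasisIndex (s + 1) n, C (c i) * P i =
      ∑ j ∈ Finset.range (s + 1), C (extendByZero c (k - j)) * P (k - j) := by
  have e : 1 - ((s + 1 : ℕ) : ℤ) = -(s : ℤ) := by push_cast; ring
  have h0 : ∑ i : BasisIndex (s + 1) n, C (c i) * P i =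
      ∑ i ∈ Finset.Icc (1 - ((s + 1 : ℕ) : ℤ)) ((n : ℤ) - 1), C (extendByZero c i) * P i := by
    refine Eq.trans ?_ (Finset.sum_coe_sort _ fun i => C (extendByZero c i) * P i)
    exact Finset.sum_congr rfl fun i _ => by rw [extendByZero_coe]
  rw [h0, e]
  symm
  refine Finset.sum_of_injOn (fun j : ℕ => k - (j : ℤ)) ?_ ?_ ?_ ?_
  · intro a _ b _ h
    simpa using h
  · intro j hj
    have := Finset.mem_range.1 hj
    simp only [Finset.coe_Icc, Set.mem_Icc]
    omega
  · intro i hi hni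
    rcases lt_or_ge k i with h | h
    · rw [h1 i hi h, mul_zero]
    · rw [h2 i hi, mul_zero]
      by_contra hcon
      refine hni ⟨(k - i).toNat, ?_, ?_⟩
      · simp only [Finset.coe_range, Set.mem_Iio]
        omega
      · simp only
        omega
  · intro j _
    rfl

theorem dotProduct_self_eq_sum_Icc {s n : ℕ} (c : BasisIndex (s + 1) n → ℝ) :
    dotProduct c c = ∑ i ∈ Finset.Icc (-(s : ℤ)) (n - 1), extendByZero c i ^ 2 := by
  have e : 1 - ((s + 1 : ℕ) : ℤ) = -(s : ℤ) := by push_cast; ring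
  rw [← e, ← Finset.sum_coe_sort]
  exact Finset.sum_congr rfl fun i _ => by rw [extendByZero_coe, sq]

/-- Every basis function is nonzero on some knot interval. -/
theorem sum_Icc_le_sum_sum {n s : ℕ} (hn : 1 ≤ n) (g : ℤ → ℝ) (hg : ∀ i, 0 ≤ g i) :
    ∑ i ∈ Finset.Icc (-(s : ℤ)) (n - 1), g i ≤
      ∑ k ∈ Finset.range n, ∑ j ∈ Finset.range (s + 1), g (k - j) := by
  rw [← Finset.sum_product', ← Finset.sum_fiberwise_of_maps_to
    (t := Finset.Icc (-(s : ℤ)) (n - 1)) (g := fun p : ℕ × ℕ => (p.1 : ℤ) - p.2)]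
  · refine Finset.sum_le_sum fun i hi => ?_
    have hi' := Finset.mem_Icc.1 hi
    have hmem : (i.toNat, (-i).toNat) ∈ {p ∈ Finset.range n ×ˢ Finset.range (s + 1) |
        (p.1 : ℤ) - p.2 = i} := by
      simp only [Finset.mem_filter, Finset.mem_product, Finset.mem_range]
      omega
    refine le_trans (le_of_eq ?_) (Finset.single_le_sum
      (f := fun p : ℕ × ℕ => g ((p.1 : ℤ) - p.2)) (fun p _ => hg _) hmem)
    exact congrArg g (by simp only; omega)
  · intro p hp
    simp only [Finset.mem_product, Finset.mem_range] at hp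
    simp only [Finset.mem_Icc]
    omega

/-- Every basis function is nonzero on at most `s + 1` knot intervals. -/
theorem sum_sum_le_sum_Icc {n s : ℕ} (g : ℤ → ℝ) (hg : ∀ i, 0 ≤ g i) :
    ∑ k ∈ Finset.range n, ∑ j ∈ Finset.range (s + 1), g (k - j) ≤
      (s + 1) * ∑ i ∈ Finset.Icc (-(s : ℤ)) (n - 1), g i := by
  rw [Finset.sum_comm]
  calc _ ≤ ∑ _j ∈ Finset.range (s + 1), ∑ i ∈ Finset.Icc (-(s : ℤ)) (n - 1), g i := by
        refine Finset.sum_le_sum fun j hj => ?_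
        have hj' := Finset.mem_range.1 hj
        rw [← Finset.sum_image (s := Finset.range n) (g := fun k : ℕ => (k : ℤ) - j)
          (f := g) (fun a _ b _ h => by simpa using h)]
        refine Finset.sum_le_sum_of_subset_of_nonneg ?_ fun i _ _ => hg i
        intro i hi
        obtain ⟨k, hk, rfl⟩ := Finset.mem_image.1 hi
        have := Finset.mem_range.1 hk
        simp only [Finset.mem_Icc]
        omega
    _ = _ := by simp


/-! ### The Gram matrix of the B-splines -/

theorem one_le_of_spacing {t : ℤ → ℝ} (ht : StrictMono t) {M : ℝ}
    (hM : ∀ i j, t (i + 1) - t i ≤ M * (t (j + 1) - t j)) : 1 ≤ M := by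
  have h1 := hM 0 0
  have h2 := sub_pos.2 (ht (lt_add_one (0 : ℤ)))
  exact le_of_mul_le_mul_right (by rwa [one_mul]) h2

/-- On one knot interval the squared `L²` norm of a spline (after rescaling to `[0, 1]`) is
comparable to the sum of the squares of the coefficients that matter there. -/
theorem exists_local_bounds (M : ℝ) (s : ℕ) :
    ∃ K : ℝ, 0 < K ∧ ∀ t : ℤ → ℝ, StrictMono t →
      (∀ i j, t (i + 1) - t i ≤ M * (t (j + 1) - t j)) → ∀ (k : ℤ) (c : ℤ → ℝ),
      ∑ j ∈ Finset.range (s + 1), c (k - j) ^ 2 ≤ K * ∫ y in (0 : ℝ)..1,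
        (rescaleToUnit t k (∑ j ∈ Finset.range (s + 1),
          C (c (k - j)) * bsplinePiece t k (s + 1) (k - j))).eval y ^ 2 := by
  obtain ⟨K₁, hK₁, h₁⟩ := exists_coeff_sq_le_integral s
  obtain ⟨K₂, hK₂, h₂⟩ := exists_abs_splineCoeff_le M s
  refine ⟨(s + 1) * (K₂ ^ 2 * K₁), by positivity, fun t ht hM k c => ?_⟩
  set q := rescaleToUnit t k (∑ j ∈ Finset.range (s + 1),
    C (c (k - j)) * bsplinePiece t k (s + 1) (k - j)) with hq
  have hint : 0 ≤ ∫ y in (0 : ℝ)..1, q.eval y ^ 2 :=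
    intervalIntegral.integral_nonneg zero_le_one fun _ _ => sq_nonneg _
  have h3 := h₂ t ht hM k c (√(K₁ * ∫ y in (0 : ℝ)..1, q.eval y ^ 2)) fun m =>
    Real.abs_le_sqrt (h₁ q ((natDegree_rescaleToUnit_le _ _ _).trans
      (natDegree_sum_bsplinePiece_le t k s c)) m)
  calc ∑ j ∈ Finset.range (s + 1), c (k - j) ^ 2
      ≤ ∑ _j ∈ Finset.range (s + 1), K₂ ^ 2 * (K₁ * ∫ y in (0 : ℝ)..1, q.eval y ^ 2) := by
        refine Finset.sum_le_sum fun j hj => ?_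
        rw [← Real.sq_sqrt (mul_nonneg hK₁.le hint), ← mul_pow, ← sq_abs]
        exact pow_le_pow_left₀ (abs_nonneg _) (h3 j hj) 2
    _ = _ := by
        rw [Finset.sum_const, Finset.card_range, nsmul_eq_mul]
        push_cast
        ring

theorem integral_sq_spline_le {t : ℤ → ℝ} (ht : StrictMono t) (k : ℤ) (s : ℕ) (c : ℤ → ℝ) :
    ∫ y in (0 : ℝ)..1, (rescaleToUnit t k (∑ j ∈ Finset.range (s + 1),
        C (c (k - j)) * bsplinePiece t k (s + 1) (k - j))).eval y ^ 2 ≤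
      (s + 1) * ∑ j ∈ Finset.range (s + 1), c (k - j) ^ 2 := by
  have h : ∀ y ∈ Set.Icc (0 : ℝ) 1, (rescaleToUnit t k (∑ j ∈ Finset.range (s + 1),
      C (c (k - j)) * bsplinePiece t k (s + 1) (k - j))).eval y ^ 2 ≤
      (s + 1) * ∑ j ∈ Finset.range (s + 1), c (k - j) ^ 2 := by
    intro y hy
    have hx := add_mem_Icc_of_mem_unit ht k hy
    rw [eval_rescaleToUnit, eval_finsetSum]
    refine sq_sum_le_card_mul_sum_sq.trans ?_
    rw [Finset.card_range]
    push_cast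
    refine mul_le_mul_of_nonneg_left (Finset.sum_le_sum fun j hj => ?_) (by positivity)
    rw [eval_mul, eval_C, mul_pow]
    exact mul_le_of_le_one_right (sq_nonneg _) (pow_le_one₀ (eval_bsplinePiece_nonneg ht hx s _)
      (eval_bsplinePiece_le_one ht hx hj))
  refine (intervalIntegral.integral_mono_on zero_le_one
    (Continuous.intervalIntegrable (by fun_prop) _ _) intervalIntegrable_const h).trans ?_
  simp

/-- The condition number of the B-spline Gram matrix is bounded in terms of the order and the
spacing ratio alone. -/
theorem exists_condNumber_gramSpline_le (s : ℕ) (M : ℝ) :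
    ∃ K : ℝ, ∀ n : ℕ, 1 ≤ n → ∀ t : ℤ → ℝ, StrictMono t →
      (∀ i j, t (i + 1) - t i ≤ M * (t (j + 1) - t j)) →
      (gramSpline (s + 1) n t).PosDef ∧ condNumber (gramSpline (s + 1) n t) ≤ K := by
  obtain ⟨K, hK, hloc⟩ := exists_local_bounds M s
  refine ⟨M ^ 2 * (s + 1) ^ 2 * K, fun n hn t ht hM => ?_⟩
  have hM1 := one_le_of_spacing ht hM
  have hM0 : 0 < M := zero_lt_one.trans_le hM1
  have hL : 0 < t n - t 0 := sub_pos.2 (ht (by omega))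
  set h := t (0 + 1) - t 0 with hh
  have hh0 : 0 < h := sub_pos.2 (ht (lt_add_one (0 : ℤ)))
  let I : (BasisIndex (s + 1) n → ℝ) → ℤ → ℝ := fun c k =>
    ∫ y in (0 : ℝ)..1, (rescaleToUnit t k (∑ j ∈ Finset.range (s + 1),
      C (extendByZero c (k - j)) * bsplinePiece t k (s + 1) (k - j))).eval y ^ 2
  have hform : ∀ c, dotProduct c ((gramSpline (s + 1) n t).mulVec c) =
      (t n - t 0)⁻¹ * ∑ k ∈ Finset.range n, (t (k + 1) - t k) * I c k := by
    intro c
    rw [gramSpline, dotProduct_gramMatrix_mulVec ht n _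
      (fun k (i : BasisIndex (s + 1) n) => bsplinePiece t k (s + 1) i)
      fun k i x hx => eval_bsplinePiece ht hx _ _]
    congr 1
    refine Finset.sum_congr rfl fun k hk => ?_
    rw [sum_basisIndex_eq_sum_range (by omega) (by simpa using hk) c
      (fun i => bsplinePiece t k (s + 1) i)
      (fun i _ hi => bsplinePiece_eq_zero_of_lt t hi s)
      (fun i _ hi => bsplinePiece_eq_zero_of_add_lt t s hi)]
  have hI : ∀ c k, 0 ≤ I c k := fun c k =>
    intervalIntegral.integral_nonneg zero_le_one fun _ _ => sq_nonneg _
  have hlow : ∀ c k, ∑ j ∈ Finset.range (s + 1), extendByZero c (k - j) ^ 2 ≤ K * I c k :=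
    fun c k => hloc t ht hM k (extendByZero c)
  have hup : ∀ c k, I c k ≤
      (s + 1) * ∑ j ∈ Finset.range (s + 1), extendByZero c (k - j) ^ 2 :=
    fun c k => integral_sq_spline_le ht k s (extendByZero c)
  have hℓ : ∀ k : ℤ, 0 ≤ t (k + 1) - t k := fun k => (sub_pos.2 (ht (lt_add_one k))).le
  have hh1 : ∀ k : ℤ, t (k + 1) - t k ≤ M * h := fun k => hM k 0
  have hh2 : ∀ k : ℤ, h ≤ M * (t (k + 1) - t k) := fun k => hM 0 k
  clear_value I h
  have hmain := posDef_and_condNumber_le (A := gramSpline (s + 1) n t)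
    (gramMatrix_isHermitian _ _ _)
    (α := (t n - t 0)⁻¹ * (h / M * K⁻¹)) (β := (t n - t 0)⁻¹ * (M * h * (s + 1) ^ 2))
    (by positivity) (by positivity) ?_ ?_
  · refine ⟨hmain.1, hmain.2.trans_eq ?_⟩
    field_simp
  · intro c
    rw [hform, mul_assoc, mul_assoc (h / M)]
    refine mul_le_mul_of_nonneg_left ?_ (inv_pos.2 hL).le
    rw [dotProduct_self_eq_sum_Icc]
    calc h / M * (K⁻¹ * ∑ i ∈ Finset.Icc (-(s : ℤ)) (n - 1), extendByZero c i ^ 2)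
        ≤ h / M * (K⁻¹ * ∑ k ∈ Finset.range n, ∑ j ∈ Finset.range (s + 1),
            extendByZero c (k - j) ^ 2) := by
          gcongr
          exact sum_Icc_le_sum_sum hn _ fun i => sq_nonneg _
      _ = ∑ k ∈ Finset.range n, h / M * (K⁻¹ * ∑ j ∈ Finset.range (s + 1),
            extendByZero c (k - j) ^ 2) := by simp only [Finset.mul_sum]
      _ ≤ _ := by
          refine Finset.sum_le_sum fun k _ => mul_le_mul ?_ ?_ (by positivity) (hℓ k)
          · rw [div_le_iff₀' hM0]
            exact hh2 k
          · rw [inv_mul_le_iff₀ hK]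
            exact hlow c k
  · intro c
    rw [hform, mul_assoc]
    refine mul_le_mul_of_nonneg_left ?_ (inv_pos.2 hL).le
    rw [dotProduct_self_eq_sum_Icc]
    calc _ ≤ ∑ k ∈ Finset.range n, M * h * ((s + 1) * ∑ j ∈ Finset.range (s + 1),
            extendByZero c (k - j) ^ 2) :=
          Finset.sum_le_sum fun k _ => mul_le_mul (hh1 k) (hup c k) (hI c k) (by positivity)
      _ = M * h * (s + 1) * ∑ k ∈ Finset.range n, ∑ j ∈ Finset.range (s + 1),
            extendByZero c (k - j) ^ 2 := by simp only [Finset.mul_sum, mul_assoc]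
      _ ≤ M * h * (s + 1) * ((s + 1) * ∑ i ∈ Finset.Icc (-(s : ℤ)) (n - 1),
            extendByZero c i ^ 2) := by
          refine mul_le_mul_of_nonneg_left ?_ (by positivity)
          exact sum_sum_le_sum_Icc (fun i => extendByZero c i ^ 2) fun i => sq_nonneg _
      _ = M * h * (s + 1) ^ 2 * ∑ i ∈ Finset.Icc (-(s : ℤ)) (n - 1),
            extendByZero c i ^ 2 := by ring

/-! ### The Gram matrix of the ReLU powers -/

/-- The polynomial that agrees with `ReLU(x - t_i)^s` on the knot interval `[t_k, t_{k+1})`. -/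
noncomputable def reluPiece (t : ℤ → ℝ) (s : ℕ) (k i : ℤ) : ℝ[X] :=
  if i ≤ k then (X - C (t i)) ^ s else 0

theorem eval_reluPiece {t : ℤ → ℝ} (ht : StrictMono t) (s : ℕ) (k i : ℤ) {x : ℝ}
    (hx : x ∈ Set.Ico (t k) (t (k + 1))) :
    reluPow t (s + 1) i x = (reluPiece t s k i).eval x := by
  rw [reluPow, reluPiece, Nat.add_sub_cancel]
  by_cases hik : i ≤ k
  · have h1 : t i ≤ x := (ht.monotone hik).trans hx.1
    rw [if_pos hik, if_pos h1, max_eq_left (sub_nonneg.2 h1)]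
    split_ifs with h
    · obtain rfl : s = 0 := by omega
      simp
    · simp
  · have h1 : x < t i := hx.2.trans_le (ht.monotone (by omega))
    rw [if_neg hik, if_neg h1.not_ge, max_eq_right (sub_nonpos.2 h1.le), eval_zero]
    split_ifs with h
    · rfl
    · exact zero_pow (by omega)

theorem eq_zero_of_rescaleToUnit_eq_zero {t : ℤ → ℝ} (ht : StrictMono t) {k : ℤ} {p : ℝ[X]}
    (h : rescaleToUnit t k p = 0) : p = 0 := by
  have hℓ : t (k + 1) - t k ≠ 0 := (sub_pos.2 (ht (lt_add_one k))).ne'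
  refine Polynomial.funext fun x => ?_
  have h1 := eval_rescaleToUnit t k p ((x - t k) / (t (k + 1) - t k))
  rw [h, mul_div_cancel₀ _ hℓ, sub_add_cancel, eval_zero] at h1
  rw [← h1, eval_zero]

/-- The `s`-th powers of `s + 1` distinct shifts of `X` are linearly independent: their
coefficients form, up to binomial factors, a Vandermonde matrix. -/
theorem eq_zero_of_sum_X_sub_C_pow_eq_zero {s : ℕ} {v a : Fin (s + 1) → ℝ}
    (ha : Function.Injective a) (h : ∑ j, C (v j) * (X - C (a j)) ^ s = 0) : v = 0 := by
  refine Matrix.eq_zero_of_forall_pow_sum_mul_pow_eq_zero (f := fun j => -a j)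
    (fun i j hij => ha (neg_injective hij)) fun m => ?_
  have hm : (m : ℕ) ≤ s := Nat.lt_succ_iff.1 m.2
  have h1 := congrArg (fun p => coeff p (s - m)) h
  simp only [finsetSum_coeff, coeff_C_mul, coeff_zero, sub_eq_add_neg, ← C_neg,
    coeff_X_add_C_pow, ← mul_assoc] at h1
  rw [← Finset.sum_mul, Nat.sub_sub_self hm] at h1
  refine (mul_eq_zero.1 h1).resolve_right ?_
  exact_mod_cast (Nat.choose_pos (Nat.sub_le s m)).ne'

/-- The Gram matrix of the truncated powers is positive definite. If the quadratic form vanishes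
at `c`, then so does the function with coefficients `c` on every knot interval. On the first one
this kills the coefficients with index at most `0`, and every further interval kills one more. -/
theorem posDef_gramReLU {s n : ℕ} (hn : 1 ≤ n) {t : ℤ → ℝ} (ht : StrictMono t) :
    (gramReLU (s + 1) n t).PosDef := by
  have hL : 0 < t n - t 0 := sub_pos.2 (ht (by omega))
  refine Matrix.posDef_iff_dotProduct_mulVec.2 ⟨gramMatrix_isHermitian _ _ _, fun c hc => ?_⟩
  rw [star_trivial, gramReLU, dotProduct_gramMatrix_mulVec ht n _
    (fun k (i : BasisIndex (s + 1) n) => reluPiece t s k i)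
    fun k i x hx => eval_reluPiece ht s k i hx]
  refine mul_pos (inv_pos.2 hL) ?_
  have hI : ∀ (k : ℤ) (p : ℝ[X]), 0 ≤ (t (k + 1) - t k) *
      ∫ y in (0 : ℝ)..1, (rescaleToUnit t k p).eval y ^ 2 := fun k p =>
    mul_nonneg (sub_pos.2 (ht (lt_add_one k))).le
      (intervalIntegral.integral_nonneg zero_le_one fun _ _ => sq_nonneg _)
  refine lt_of_le_of_ne' (Finset.sum_nonneg fun (k : ℕ) _ => hI k _) fun h0 => hc ?_
  rw [Finset.sum_eq_zero_iff_of_nonneg fun (k : ℕ) _ => hI k _] at h0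
  have hp : ∀ k : ℕ, k < n →
      ∑ i : BasisIndex (s + 1) n, C (c i) * reluPiece t s k i = 0 := by
    intro k hk
    refine eq_zero_of_rescaleToUnit_eq_zero ht (k := k) ?_
    have h1 := (mul_eq_zero.1 (h0 k (Finset.mem_range.2 hk))).resolve_left
      (sub_pos.2 (ht (lt_add_one (k : ℤ)))).ne'
    obtain ⟨K, _, hK⟩ := exists_coeff_sq_le_integral (rescaleToUnit t k
      (∑ i : BasisIndex (s + 1) n, C (c i) * reluPiece t s k i)).natDegree
    ext m
    have h2 := hK _ le_rfl m
    rw [h1, mul_zero] at h2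
    exact pow_eq_zero_iff two_ne_zero |>.1 (le_antisymm h2 (sq_nonneg _))
  have hbase : ∀ i : BasisIndex (s + 1) n, (i : ℤ) ≤ 0 → c i = 0 := by
    have h1 := hp 0 (by omega)
    rw [sum_basisIndex_eq_sum_range (k := ((0 : ℕ) : ℤ)) (by simp) (by omega) c
      (fun i => reluPiece t s ((0 : ℕ) : ℤ) i)
      (fun i _ hi => if_neg hi.not_ge)
      (fun i hi hi' => by have := Finset.mem_Icc.1 hi; omega),
      ← Fin.sum_univ_eq_sum_range (fun j => C (extendByZero c (((0 : ℕ) : ℤ) - j)) *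
        reluPiece t s ((0 : ℕ) : ℤ) (((0 : ℕ) : ℤ) - j))] at h1
    have h2 := eq_zero_of_sum_X_sub_C_pow_eq_zero (s := s)
      (v := fun j => extendByZero c (-(j : ℕ))) (a := fun j => t (-(j : ℕ)))
      (fun i j hij => Fin.ext (by simpa using ht.injective hij)) (by
        rw [← h1]
        refine Finset.sum_congr rfl fun j _ => ?_
        rw [reluPiece, if_pos (by omega)]
        simp)
    intro i hi
    have hi' := Finset.mem_Icc.1 i.2
    have h3 := congrFun h2 ⟨(-(i : ℤ)).toNat, by omega⟩
    simp only [Pi.zero_apply] at h3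
    rwa [show (-(((-(i : ℤ)).toNat : ℕ) : ℤ)) = i by omega, extendByZero_coe] at h3
  have hall : ∀ (k : ℕ) (i : BasisIndex (s + 1) n), (i : ℤ) ≤ k → c i = 0 := by
    intro k
    induction k with
    | zero => exact fun i hi => hbase i (by simpa using hi)
    | succ k ih =>
      intro i hi
      rcases hi.lt_or_eq with hlt | heq
      · exact ih i (by push_cast at hlt; omega)
      have hi' := Finset.mem_Icc.1 i.2
      have h1 := hp (k + 1) (by omega)
      rw [Finset.sum_eq_single i] at h1
      · rw [reluPiece, if_pos hi] at h1
        exact C_eq_zero.1 ((mul_eq_zero.1 h1).resolve_right (pow_ne_zero _ (X_sub_C_ne_zero _)))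
      · intro j _ hji
        rcases lt_or_ge ((k + 1 : ℕ) : ℤ) (j : ℤ) with h | h
        · rw [reluPiece, if_neg h.not_ge, mul_zero]
        · have : (j : ℤ) ≠ i := fun h => hji (Subtype.ext h)
          rw [ih j (by push_cast at h heq; omega), C_0, zero_mul]
      · simp
  funext i
  exact hall (i : ℤ).toNat i (Int.self_le_toNat _)

theorem gramReLU_diag {s n : ℕ} {t : ℤ → ℝ} (ht : StrictMono t) (i : BasisIndex (s + 1) n) :
    gramReLU (s + 1) n t i i = (t n - t 0)⁻¹ * ∑ k ∈ Finset.range n, (t (k + 1) - t k) *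
      ∫ y in (0 : ℝ)..1, (rescaleToUnit t k (reluPiece t s k i)).eval y ^ 2 := by
  have h := dotProduct_gramMatrix_mulVec ht n (fun i : BasisIndex (s + 1) n => reluPow t (s + 1) i)
    (fun k i => reluPiece t s k i) (fun k i x hx => eval_reluPiece ht s k i hx) (Pi.single i 1)
  simpa [gramReLU, Pi.single_apply, apply_ite (C : ℝ → ℝ[X])] using h

/-- The last truncated power lives on the last knot interval only. -/
theorem gramReLU_diag_last_le {s n : ℕ} {t : ℤ → ℝ} (ht : StrictMono t)
    (i : BasisIndex (s + 1) n) (hi : (i : ℤ) = n - 1) :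
    gramReLU (s + 1) n t i i ≤ (t n - t 0)⁻¹ * (t n - t (n - 1)) ^ (2 * s + 1) := by
  have hn : 1 ≤ n ∨ n = 0 := by omega
  have hL : 0 ≤ t n - t 0 := sub_nonneg.2 (ht.monotone (by omega))
  rw [gramReLU_diag ht]
  refine mul_le_mul_of_nonneg_left ?_ (inv_nonneg.2 hL)
  rcases hn with hn | rfl
  swap
  · simp only [Finset.range_zero, Finset.sum_empty]
    exact pow_nonneg (sub_nonneg.2 (ht.monotone (by omega))) _
  rw [Finset.sum_eq_single (n - 1)]
  · have e : ((n - 1 : ℕ) : ℤ) = i := by omega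
    have hℓ : 0 ≤ t (i + 1) - t i := (sub_pos.2 (ht (lt_add_one (i : ℤ)))).le
    have e' : t n - t (n - 1) = t (i + 1) - t i := by
      rw [hi, sub_add_cancel]
    rw [e, reluPiece, if_pos le_rfl, e', pow_succ' _ (2 * s)]
    refine mul_le_mul_of_nonneg_left ?_ hℓ
    have h : ∀ y ∈ Set.Icc (0 : ℝ) 1, (rescaleToUnit t i ((X - C (t i)) ^ s)).eval y ^ 2 ≤
        (t (i + 1) - t i) ^ (2 * s) := by
      intro y hy
      rw [eval_rescaleToUnit, eval_pow, eval_sub, eval_X, eval_C, add_sub_cancel_right, ← pow_mul,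
        mul_comm s 2]
      exact pow_le_pow_left₀ (mul_nonneg hℓ hy.1) (mul_le_of_le_one_right hℓ hy.2) _
    refine (intervalIntegral.integral_mono_on zero_le_one
      (Continuous.intervalIntegrable (by fun_prop) _ _) intervalIntegrable_const h).trans ?_
    simp
  · intro k hk hkn
    have := Finset.mem_range.1 hk
    rw [reluPiece, if_neg (by omega)]
    simp [rescaleToUnit]
  · intro h
    exact absurd (Finset.mem_range.2 (by omega)) h

theorem le_mul_sub_of_spacing {t : ℤ → ℝ} {M : ℝ}
    (hM : ∀ i j, t (i + 1) - t i ≤ M * (t (j + 1) - t j)) (i : ℤ) (k : ℕ) :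
    k * (t (i + 1) - t i) ≤ M * (t k - t 0) := by
  induction k with
  | zero => simp
  | succ k ih =>
    have h := hM i k
    push_cast
    linarith

/-- The truncated powers centred at or before `t_0` are large on all but boundedly many knot
intervals. -/
theorem le_gramReLU_diag {s n : ℕ} {t : ℤ → ℝ} (ht : StrictMono t) {M : ℝ}
    (hM : ∀ i j, t (i + 1) - t i ≤ M * (t (j + 1) - t j))
    (i : BasisIndex (s + 1) n) (hi : (i : ℤ) ≤ 0) (l : ℤ) :
    (t n - t 0)⁻¹ * ((n - ⌈M⌉₊ : ℝ) / M * (t (l + 1) - t l) ^ (2 * s + 1)) ≤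
      gramReLU (s + 1) n t i i := by
  have hM1 := one_le_of_spacing ht hM
  have hM0 : 0 < M := zero_lt_one.trans_le hM1
  have hL : 0 ≤ t n - t 0 := sub_nonneg.2 (ht.monotone (by omega))
  have hℓ : 0 < t (l + 1) - t l := sub_pos.2 (ht (lt_add_one l))
  set ℓ := t (l + 1) - t l with hℓ_def
  rw [gramReLU_diag ht]
  refine mul_le_mul_of_nonneg_left ?_ (inv_nonneg.2 hL)
  have hterm : ∀ k ∈ Finset.Ico ⌈M⌉₊ n, ℓ / M * ℓ ^ (2 * s) ≤ (t (k + 1) - t k) *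
      ∫ y in (0 : ℝ)..1, (rescaleToUnit t k (reluPiece t s k i)).eval y ^ 2 := by
    intro k hk
    have hkM : M ≤ k := (Nat.le_ceil M).trans (by exact_mod_cast (Finset.mem_Ico.1 hk).1)
    have hk0 : 0 < t ((k : ℤ) + 1) - t k := sub_pos.2 (ht (lt_add_one (k : ℤ)))
    refine mul_le_mul ?_ ?_ (by positivity) hk0.le
    · rw [div_le_iff₀' hM0]
      exact hM l k
    have hfar : ℓ ≤ t k - t i := by
      have h1 := le_mul_sub_of_spacing hM l k
      have h2 : M * ℓ ≤ M * (t k - t 0) := (mul_le_mul_of_nonneg_right hkM hℓ.le).trans h1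
      have h3 : t i ≤ t 0 := ht.monotone hi
      linarith [le_of_mul_le_mul_left h2 hM0]
    have h : ∀ y ∈ Set.Icc (0 : ℝ) 1,
        ℓ ^ (2 * s) ≤ (rescaleToUnit t k (reluPiece t s k i)).eval y ^ 2 := by
      intro y hy
      rw [reluPiece, if_pos (by omega), eval_rescaleToUnit, eval_pow, eval_sub, eval_X, eval_C,
        ← pow_mul, mul_comm s 2]
      refine pow_le_pow_left₀ hℓ.le ?_ _
      have := mul_nonneg hk0.le hy.1
      linarith
    have := intervalIntegral.integral_mono_on zero_le_one intervalIntegrable_const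
      (Continuous.intervalIntegrable (μ := volume) (by fun_prop) _ _) h
    simpa using this
  calc (n - ⌈M⌉₊ : ℝ) / M * ℓ ^ (2 * s + 1)
      = (n - ⌈M⌉₊ : ℝ) * (ℓ / M * ℓ ^ (2 * s)) := by ring
    _ ≤ ((n - ⌈M⌉₊ : ℕ) : ℝ) * (ℓ / M * ℓ ^ (2 * s)) := by
        gcongr
        rw [sub_le_iff_le_add]
        exact_mod_cast (show n ≤ n - ⌈M⌉₊ + ⌈M⌉₊ by omega)
    _ = ∑ _k ∈ Finset.Ico ⌈M⌉₊ n, ℓ / M * ℓ ^ (2 * s) := by simp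
    _ ≤ _ := Finset.sum_le_sum hterm
    _ ≤ _ := Finset.sum_le_sum_of_subset_of_nonneg
        (fun k hk => Finset.mem_range.2 (Finset.mem_Ico.1 hk).2) fun k _ _ =>
        mul_nonneg (sub_pos.2 (ht (lt_add_one (k : ℤ)))).le
          (intervalIntegral.integral_nonneg zero_le_one fun _ _ => sq_nonneg _)

/-- The condition number of the Gram matrix of the truncated powers grows at least linearly in the
number of knots: compare the first and the last diagonal entries. -/
theorem le_condNumber_gramReLU {s n : ℕ} (hn : 1 ≤ n) {t : ℤ → ℝ} (ht : StrictMono t) {M : ℝ}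
    (hM : ∀ i j, t (i + 1) - t i ≤ M * (t (j + 1) - t j)) :
    (n - ⌈M⌉₊ : ℝ) / M ≤ condNumber (gramReLU (s + 1) n t) := by
  have hpd : (gramReLU (s + 1) n t).PosDef := posDef_gramReLU hn ht
  let i : BasisIndex (s + 1) n := ⟨0, Finset.mem_Icc.2 (by omega)⟩
  let j : BasisIndex (s + 1) n := ⟨n - 1, Finset.mem_Icc.2 (by omega)⟩
  refine le_trans ?_ (diag_div_diag_le_condNumber hpd i j)
  have hj : 0 < gramReLU (s + 1) n t j j := hpd.diag_pos
  rw [le_div_iff₀ hj]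
  have hL : 0 < t n - t 0 := sub_pos.2 (ht (by omega))
  rcases le_or_gt ((n - ⌈M⌉₊ : ℝ) / M) 0 with h | h
  · exact (mul_nonpos_of_nonpos_of_nonneg h hj.le).trans hpd.diag_pos.le
  have h1 := gramReLU_diag_last_le ht j rfl
  have h2 := le_gramReLU_diag ht hM i le_rfl (n - 1)
  rw [sub_add_cancel] at h2
  calc _ ≤ (n - ⌈M⌉₊ : ℝ) / M * ((t n - t 0)⁻¹ * (t n - t (n - 1)) ^ (2 * s + 1)) :=
        mul_le_mul_of_nonneg_left h1 h.le
    _ = (t n - t 0)⁻¹ * ((n - ⌈M⌉₊ : ℝ) / M * (t n - t (n - 1)) ^ (2 * s + 1)) := by ring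
    _ ≤ _ := h2

end

/-! ### Condition numbers of the two bases -/

theorem mainTheorem2 (r : ℕ) (hr : 1 ≤ r) (M : ℝ) :
    (∃ C : ℝ, ∀ n : ℕ, 1 ≤ n → ∀ t : ℤ → ℝ, IsKnotSequence r n t → SpacingRatioLE r n t M →
      (gramSpline r n t).PosDef ∧ condNumber (gramSpline r n t) ≤ C) ∧
    (∀ n : ℕ, 1 ≤ n → ∀ t : ℤ → ℝ, IsKnotSequence r n t → SpacingRatioLE r n t M →
      (gramReLU r n t).PosDef) ∧
    (∀ B : ℝ, ∃ N : ℕ, ∀ n : ℕ, N ≤ n → ∀ t : ℤ → ℝ,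
      IsKnotSequence r n t → SpacingRatioLE r n t M → B < condNumber (gramReLU r n t)) := by
  obtain ⟨s, rfl⟩ : ∃ s, r = s + 1 := ⟨r - 1, by omega⟩
  refine ⟨?_, fun n hn t ht hM => ?_, fun B => ?_⟩
  · obtain ⟨K, hK⟩ := exists_condNumber_gramSpline_le s M
    refine ⟨K, fun n hn t ht hM => ?_⟩
    obtain ⟨u, hu, huM, htu⟩ := exists_strictMono_extension hr hn ht hM
    rw [gramSpline_congr hr htu]
    exact hK n hn u hu huM
  · obtain ⟨u, hu, huM, htu⟩ := exists_strictMono_extension hr hn ht hM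
    rw [gramReLU_congr hr htu]
    exact posDef_gramReLU hn hu
  · refine ⟨⌈M⌉₊ + ⌈M * |B|⌉₊ + 1, fun n hN t ht hM => ?_⟩
    have hn : 1 ≤ n := by omega
    obtain ⟨u, hu, huM, htu⟩ := exists_strictMono_extension hr hn ht hM
    rw [gramReLU_congr hr htu]
    refine lt_of_lt_of_le ?_ (le_condNumber_gramReLU hn hu huM)
    have hM0 : 0 < M := zero_lt_one.trans_le (one_le_of_spacing hu huM)
    rw [lt_div_iff₀' hM0]
    have h1 : ((⌈M⌉₊ + ⌈M * |B|⌉₊ + 1 : ℕ) : ℝ) ≤ n := by exact_mod_cast hN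
    push_cast at h1
    have h2 := Nat.le_ceil (M * |B|)
    have h3 := mul_le_mul_of_nonneg_left (le_abs_self B) hM0.le
    linarith
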